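/- Let $F,f:\mathbb{R}^n\times\mathbb{R}^m\to\mathbb{R}$, $G:\mathbb{R}^n\times\mathbb{R}^m\to\mathbb{R}^p$ and $g:\mathbb{R}^n\times\mathbb{R}^m\to\mathbb{R}^q$ be functions and let $\lambda_1,\lambda_2\in\mathbb{R}$. **Semismoothness.** For a map $\psi:\mathbb{R}^N\to\mathbb{R}^M$, let $\partial\psi(\bar x)$ be the convex hull of the set of all limits of Jacobians $\lim_k\nabla\psi(x^k)$, where $x^k\to\bar x$ and $\psi$ is differentiable at every $x^k$. A locally Lipschitz map $\psi$ is *semismooth at* $\bar x$ if for every $d\in\mathbb{R}^N$ the limit $\lim\{Vd' \mid V\in\partial\psi(\bar x+td'),\ d'\to d,\ t\downarrow 0\}$ exists. It is *strongly semismooth at* $\bar x$ if it is semismooth at $\bar x$, all directional derivatives $\psi'(\bar x;d)$ exist, and $Vd-\psi'(\bar x;d)=O(\|d\|^2)$ for all $V\in\partial\psi(\bar x+d)$, as $d\to 0$. It is *(strongly) semismooth* if it is so at every point. A real-valued function $\psi$ is SC$^1$ if it is $C^1$ and $\nabla\psi$ is semismooth; it is LC$^2$ if it is $C^2$ and $\nabla^2\psi$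 is locally Lipschitz. A vector-valued function is SC$^1$ (LC$^2$) if all its components are. **The maps.** Let $\ell(x,y,z)=f(x,y)+z^\top g(x,y)$ and $\bar\ell(x,y,z)=f(x,y)-z^\top g(x,y)$, and write $\nabla_2$ for the gradient with respect to the second variable. Let $\psi_{\mathrm{FB}}(a,b)$ be the vector with components $\sqrt{a_i^2+b_i^2}-a_i-b_i$. For $x\in\mathbb{R}^n$, $y,s\in\mathbb{R}^m$, $u\in\mathbb{R}^p$, $z,v,w\in\mathbb{R}^q$ put $\zeta^1=(x,y,z,s,u,v,w)$, $$\mathcal{L}_1^{\lambda_1}(\zeta^1)=F(x,y)+u^\top G(x,y)+(v+\lambda_1 z)^\top g(x,y)+s^\top\nabla_2\bar\ell(x,y,z)+w^\top z,$$ $$\Phi_1^{\lambda_1}(\zeta^1)=\bigl(\nabla_{(x,y,z)}\mathcal{L}_1^{\lambda_1}(\zeta^1),\ \nabla_2\bar\ell(x,y,z),\ \psi_{\mathrm{FB}}(-G(x,y),u),\ \psi_{\mathrm{FB}}(-g(x,y),v),\ \psi_{\mathrm{FB}}(-z,w)\bigr).$$ For $x\in\mathbb{R}^n$, $y,z\in\mathbb{R}^m$,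 $u\in\mathbb{R}^p$, $v,w\in\mathbb{R}^q$ put $\zeta^2=(x,y,z,u,v,w)$, $$\mathcal{L}_2^{\lambda_2}(\zeta^2)=F(x,y)+u^\top G(x,y)+v^\top g(x,y)+\lambda_2 f(x,y)-\lambda_2\,\ell(x,z,w),$$ $$\Phi_2^{\lambda_2}(\zeta^2)=\bigl(\nabla_{(x,y,z)}\mathcal{L}_2^{\lambda_2}(\zeta^2),\ \psi_{\mathrm{FB}}(-G(x,y),u),\ \psi_{\mathrm{FB}}(-g(x,y),v),\ \psi_{\mathrm{FB}}(-g(x,z),w)\bigr).$$ **Theorem.** (i) Suppose that $f$ and $g$ are $C^1$. If $F$, $G$, $\nabla f$ and $\nabla g_i$, $i=1,\dots,q$, are SC$^1$ (resp. LC$^2$), then $\Phi_1^{\lambda_1}$ is semismooth (resp. strongly semismooth). (ii) If $F$, $G$, $f$ and $g$ are SC$^1$ (resp. LC$^2$), then $\Phi_2^{\lambda_2}$ is semismooth (resp. strongly semismooth). -/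

import Mathlib

open Filter Topology

noncomputable section

namespace Bilevel

section Semismoothness

variable {E F : Type*} [NormedAddCommGroup E] [NormedSpace ℝ E]
  [NormedAddCommGroup F] [NormedSpace ℝ F]

/-- The B-subdifferential of `ψ` at `x`: all limits of Jacobians `ψ'(x_k)` along sequences
`x_k → x` of points of differentiability of `ψ`. -/
def bSubdifferential (ψ : E → F) (x : E) : Set (E →L[ℝ] F) :=
  {V | ∃ u : ℕ → E, Tendsto u atTop (𝓝 x) ∧ (∀ k, DifferentiableAt ℝ ψ (u k)) ∧
    Tendsto (fun k => fderiv ℝ ψ (u k)) atTop (𝓝 V)}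

/-- Clarke's generalized Jacobian: the convex hull of the B-subdifferential. -/
def clarkeJacobian (ψ : E → F) (x : E) : Set (E →L[ℝ] F) :=
  convexHull ℝ (bSubdifferential ψ x)

/-- `η` is the (one-sided) directional derivative `ψ'(x; d)`. -/
def HasDirDeriv (ψ : E → F) (x d : E) (η : F) : Prop :=
  Tendsto (fun t : ℝ => t⁻¹ • (ψ (x + t • d) - ψ x)) (𝓝[>] 0) (𝓝 η)

/-- A locally Lipschitz map `ψ` is semismooth at `x` if for every direction `d` the limit of
`V d'` over `V ∈ ∂ψ(x + t d')`, `d' → d`, `t ↓ 0`, exists. -/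
def IsSemismoothAt (ψ : E → F) (x : E) : Prop :=
  LocallyLipschitz ψ ∧
    ∀ d : E, ∃ L : F, ∀ ε > 0, ∃ δ > 0, ∀ (d' : E) (t : ℝ), ‖d' - d‖ < δ → 0 < t → t < δ →
      ∀ V ∈ clarkeJacobian ψ (x + t • d'), ‖V d' - L‖ < ε

/-- `ψ` is strongly semismooth at `x` if it is semismooth at `x` and
`V d - ψ'(x; d) = O(‖d‖²)` for `V ∈ ∂ψ(x + d)`, `d → 0`. -/
def IsStronglySemismoothAt (ψ : E → F) (x : E) : Prop :=
  IsSemismoothAt ψ x ∧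
    ∃ D : E → F, (∀ d, HasDirDeriv ψ x d (D d)) ∧
      ∃ C : ℝ, ∃ δ > 0, ∀ d : E, ‖d‖ < δ →
        ∀ V ∈ clarkeJacobian ψ (x + d), ‖V d - D d‖ ≤ C * ‖d‖ ^ 2

def IsSemismooth (ψ : E → F) : Prop := ∀ x, IsSemismoothAt ψ x

def IsStronglySemismooth (ψ : E → F) : Prop := ∀ x, IsStronglySemismoothAt ψ x

end Semismoothness

section Smoothness

variable {ι κ : Type*} [Fintype ι] [Fintype κ]

/-- SC¹ for a real-valued function: continuously differentiable with semismooth gradient. -/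
def IsSC1 (ψ : EuclideanSpace ℝ ι → ℝ) : Prop :=
  ContDiff ℝ 1 ψ ∧ IsSemismooth (gradient ψ)

/-- LC² for a real-valued function: twice continuously differentiable with locally Lipschitz
Hessian; the Hessian is the derivative of the gradient map. -/
def IsLC2 (ψ : EuclideanSpace ℝ ι → ℝ) : Prop :=
  ContDiff ℝ 2 ψ ∧ LocallyLipschitz (fderiv ℝ (gradient ψ))

/-- A vector-valued function is SC¹ if all its components are. -/
def IsSC1Vec (ψ : EuclideanSpace ℝ ι → EuclideanSpace ℝ κ) : Prop :=
  ∀ i, IsSC1 fun x => ψ x i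

/-- A vector-valued function is LC² if all its components are. -/
def IsLC2Vec (ψ : EuclideanSpace ℝ ι → EuclideanSpace ℝ κ) : Prop :=
  ∀ i, IsLC2 fun x => ψ x i

/-- The concatenation `(a, b)` of two vectors. -/
def pair (a : EuclideanSpace ℝ ι) (b : EuclideanSpace ℝ κ) : EuclideanSpace ℝ (ι ⊕ κ) :=
  WithLp.toLp 2 (Sum.elim (fun i => a i) (fun k => b k))

/-- The first block of a concatenated vector. -/
def fstBlock (c : EuclideanSpace ℝ (ι ⊕ κ)) : EuclideanSpace ℝ ι :=
  WithLp.toLp 2 fun i => c (Sum.inl i)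

/-- The second block of a concatenated vector. -/
def sndBlock (c : EuclideanSpace ℝ (ι ⊕ κ)) : EuclideanSpace ℝ κ :=
  WithLp.toLp 2 fun k => c (Sum.inr k)

/-- The Fischer-Burmeister function. -/
def fischerBurmeister (a b : ℝ) : ℝ := √(a ^ 2 + b ^ 2) - a - b

/-- The Fischer-Burmeister function applied componentwise. -/
def psiFB (a b : EuclideanSpace ℝ ι) : EuclideanSpace ℝ ι :=
  WithLp.toLp 2 fun i => fischerBurmeister (a i) (b i)

end Smoothness

section Systems

variable {n m p q : ℕ}

/-- The lower-level Lagrangian `ℓ(x, y, z) = f(x, y) + zᵀ g(x, y)`. -/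
def lowerLagrangian (f : EuclideanSpace ℝ (Fin n ⊕ Fin m) → ℝ)
    (g : EuclideanSpace ℝ (Fin n ⊕ Fin m) → EuclideanSpace ℝ (Fin q))
    (x : EuclideanSpace ℝ (Fin n)) (y : EuclideanSpace ℝ (Fin m))
    (z : EuclideanSpace ℝ (Fin q)) : ℝ :=
  f (pair x y) + inner ℝ z (g (pair x y))

/-- The function `ℓ̄(x, y, z) = f(x, y) - zᵀ g(x, y)`. -/
def lowerLagrangianBar (f : EuclideanSpace ℝ (Fin n ⊕ Fin m) → ℝ)
    (g : EuclideanSpace ℝ (Fin n ⊕ Fin m) → EuclideanSpace ℝ (Fin q))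
    (x : EuclideanSpace ℝ (Fin n)) (y : EuclideanSpace ℝ (Fin m))
    (z : EuclideanSpace ℝ (Fin q)) : ℝ :=
  f (pair x y) - inner ℝ z (g (pair x y))

/-- The partial gradient `∇₂ ℓ̄(x, y, z)` of `ℓ̄` with respect to `y`. -/
def gradYLagrangianBar (f : EuclideanSpace ℝ (Fin n ⊕ Fin m) → ℝ)
    (g : EuclideanSpace ℝ (Fin n ⊕ Fin m) → EuclideanSpace ℝ (Fin q))
    (x : EuclideanSpace ℝ (Fin n)) (y : EuclideanSpace ℝ (Fin m))
    (z : EuclideanSpace ℝ (Fin q)) : EuclideanSpace ℝ (Fin m) :=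
  gradient (fun y' => lowerLagrangianBar f g x y' z) y

/-- The Lagrangian `L₁` of the KKT reformulation, at `(x, y, z, s, u, v, w)`. -/
def kktLagrangian (lam : ℝ) (F : EuclideanSpace ℝ (Fin n ⊕ Fin m) → ℝ)
    (G : EuclideanSpace ℝ (Fin n ⊕ Fin m) → EuclideanSpace ℝ (Fin p))
    (f : EuclideanSpace ℝ (Fin n ⊕ Fin m) → ℝ)
    (g : EuclideanSpace ℝ (Fin n ⊕ Fin m) → EuclideanSpace ℝ (Fin q))
    (x : EuclideanSpace ℝ (Fin n)) (y : EuclideanSpace ℝ (Fin m))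
    (z : EuclideanSpace ℝ (Fin q)) (s : EuclideanSpace ℝ (Fin m))
    (u : EuclideanSpace ℝ (Fin p)) (v w : EuclideanSpace ℝ (Fin q)) : ℝ :=
  F (pair x y) + inner ℝ u (G (pair x y)) + inner ℝ (v + lam • z) (g (pair x y))
    + inner ℝ s (gradYLagrangianBar f g x y z) + inner ℝ w z

/-- The Lagrangian `L₂` of the value function reformulation, at `(x, y, z, u, v, w)`. -/
def vfLagrangian (lam : ℝ) (F : EuclideanSpace ℝ (Fin n ⊕ Fin m) → ℝ)
    (G : EuclideanSpace ℝ (Fin n ⊕ Fin m) → EuclideanSpace ℝ (Fin p))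
    (f : EuclideanSpace ℝ (Fin n ⊕ Fin m) → ℝ)
    (g : EuclideanSpace ℝ (Fin n ⊕ Fin m) → EuclideanSpace ℝ (Fin q))
    (x : EuclideanSpace ℝ (Fin n)) (y z : EuclideanSpace ℝ (Fin m))
    (u : EuclideanSpace ℝ (Fin p)) (v w : EuclideanSpace ℝ (Fin q)) : ℝ :=
  F (pair x y) + inner ℝ u (G (pair x y)) + inner ℝ v (g (pair x y))
    + lam * f (pair x y) - lam * lowerLagrangian f g x z w

/-- The map `Φ₁` of the KKT reformulation. Its argument is `ζ = ((x, y, z), (s, u, v, w))`; its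
first block is the gradient of `L₁` with respect to `(x, y, z)`. -/
def kktSystem (lam : ℝ) (F : EuclideanSpace ℝ (Fin n ⊕ Fin m) → ℝ)
    (G : EuclideanSpace ℝ (Fin n ⊕ Fin m) → EuclideanSpace ℝ (Fin p))
    (f : EuclideanSpace ℝ (Fin n ⊕ Fin m) → ℝ)
    (g : EuclideanSpace ℝ (Fin n ⊕ Fin m) → EuclideanSpace ℝ (Fin q))
    (ζ : EuclideanSpace ℝ ((Fin n ⊕ Fin m ⊕ Fin q) ⊕ (Fin m ⊕ Fin p ⊕ Fin q ⊕ Fin q))) :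
    EuclideanSpace ℝ ((Fin n ⊕ Fin m ⊕ Fin q) ⊕ (Fin m ⊕ Fin p ⊕ Fin q ⊕ Fin q)) :=
  let ξ := fstBlock ζ
  let x := fstBlock ξ
  let y := fstBlock (sndBlock ξ)
  let z := sndBlock (sndBlock ξ)
  let s := fstBlock (sndBlock ζ)
  let u := fstBlock (sndBlock (sndBlock ζ))
  let v := fstBlock (sndBlock (sndBlock (sndBlock ζ)))
  let w := sndBlock (sndBlock (sndBlock (sndBlock ζ)))
  pair
    (gradient (fun ξ' => kktLagrangian lam F G f g
      (fstBlock ξ') (fstBlock (sndBlock ξ')) (sndBlock (sndBlock ξ')) s u v w) ξ)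
    (pair (gradYLagrangianBar f g x y z)
      (pair (psiFB (-G (pair x y)) u)
        (pair (psiFB (-g (pair x y)) v) (psiFB (-z) w))))

/-- The map `Φ₂` of the value function reformulation. Its argument is `ζ = ((x, y, z), (u, v, w))`;
its first block is the gradient of `L₂` with respect to `(x, y, z)`. -/
def vfSystem (lam : ℝ) (F : EuclideanSpace ℝ (Fin n ⊕ Fin m) → ℝ)
    (G : EuclideanSpace ℝ (Fin n ⊕ Fin m) → EuclideanSpace ℝ (Fin p))
    (f : EuclideanSpace ℝ (Fin n ⊕ Fin m) → ℝ)
    (g : EuclideanSpace ℝ (Fin n ⊕ Fin m) → EuclideanSpace ℝ (Fin q))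
    (ζ : EuclideanSpace ℝ ((Fin n ⊕ Fin m ⊕ Fin m) ⊕ (Fin p ⊕ Fin q ⊕ Fin q))) :
    EuclideanSpace ℝ ((Fin n ⊕ Fin m ⊕ Fin m) ⊕ (Fin p ⊕ Fin q ⊕ Fin q)) :=
  let ξ := fstBlock ζ
  let x := fstBlock ξ
  let y := fstBlock (sndBlock ξ)
  let z := sndBlock (sndBlock ξ)
  let u := fstBlock (sndBlock ζ)
  let v := fstBlock (sndBlock (sndBlock ζ))
  let w := sndBlock (sndBlock (sndBlock ζ))
  pair
    (gradient (fun ξ' => vfLagrangian lam F G f g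
      (fstBlock ξ') (fstBlock (sndBlock ξ')) (sndBlock (sndBlock ξ')) u v w) ξ)
    (pair (psiFB (-G (pair x y)) u)
      (pair (psiFB (-g (pair x y)) v) (psiFB (-g (pair x z)) w)))

end Systems

end Bilevel

end

/-!
Semismoothness is defined through Clarke's generalized Jacobian, which obeys only poor calculus
rules: a composition may be differentiable at points where its ingredients are not. The proof
replaces it by an equivalent property that does not mention derivatives. Call `ψ` *ray-semismooth*
at `x` if there is a Lipschitz, positively homogeneous `D` with
`ψ(x + h) - ψ(x + r h) = (1 - r) D h + o((1 - r) ‖h‖)` as `h → 0`, uniformly in `r ∈ [0, 1]`; in the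
strong variant the error is `O((1 - r) ‖h‖²)`.

* Ray-semismoothness is stable under composition (`RaySemismoothAt.comp`), hence under sums and
  products. It holds, in the strong form, for maps with locally Lipschitz derivative
  (`RaySemismoothAt.of_lipschitzOnWith_fderiv`) and for Euclidean norms (`raySemismooth_norm`), hence
  for the Fischer-Burmeister function.
* It implies (strong) semismoothness: letting `r → 1` gives the estimate for `ψ'(x + h) h` at points
  of differentiability, and limits and convex combinations give it for the whole generalized Jacobian
  (`RaySemismoothAt.isSemismoothAt`, `RaySemismooth.isStronglySemismooth`).
* Conversely, in finite dimensions semismoothness implies ray-semismoothness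
  (`IsSemismoothAt.raySemismoothAt`). By the theorems of Rademacher and Fubini, `ψ` is differentiable
  at almost every point of almost every ray from `x`. Along such a ray the definition of
  semismoothness controls the derivative of `ψ`, hence its increments; the other rays follow by
  density. For LC² data this converse is not needed, since their gradients have locally Lipschitz
  derivatives.

The `C¹` functions with (strongly) ray-semismooth derivative form an algebra that is stable under
composition with linear maps on the right (`RaySmooth`). Both Lagrangians belong to it, as functions
of all their variables. Their partial gradients are linear images of their derivatives, and the
remaining blocks of the two systems are compositions of ray-semismooth maps.
-/

open Set Asymptotics
open scoped NNReal

set_option linter.unusedSectionVars false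

namespace Bilevel

/-! ### Ray-semismooth maps and their calculus -/

section RayRemainder

variable {E F H : Type*} [NormedAddCommGroup E] [NormedSpace ℝ E]
  [NormedAddCommGroup F] [NormedSpace ℝ F] [NormedAddCommGroup H] [NormedSpace ℝ H]

/-- The filter of pairs `(h, r)` with `h → 0`, uniformly in `r ∈ [0, 1]`. -/
def rayFilter (E : Type*) [NormedAddCommGroup E] : Filter (E × ℝ) :=
  𝓝 (0 : E) ×ˢ 𝓟 (Icc (0 : ℝ) 1)

/-- `A (h, r) = o((1 - r) ‖h‖)` and, in the strong case, `A (h, r) = O((1 - r) ‖h‖²)`, as `h → 0`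
uniformly in `r ∈ [0, 1]`. -/
def RayNegligible (strong : Prop) (A : E × ℝ → F) : Prop :=
  A =o[rayFilter E] (fun p => (1 - p.2) * ‖p.1‖) ∧
    (strong → A =O[rayFilter E] fun p => (1 - p.2) * ‖p.1‖ ^ 2)

/-- `ψ(x + h) - ψ(x + r h) - (1 - r) D h`: the error made when `D` is used to predict the increment
of `ψ` over the end piece of the ray from `x` to `x + h`. -/
def rayRemainder (ψ : E → F) (x : E) (D : E → F) (p : E × ℝ) : F :=
  ψ (x + p.1) - ψ (x + p.2 • p.1) - (1 - p.2) • D p.1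

/-- `ψ` is (strongly) ray-semismooth at `x`: a positively homogeneous Lipschitz map `D` predicts the
increments of `ψ` over all radial segments `[x + r h, x + h]` up to `o` of their length (in the
strong case, up to `O(‖h‖)` times their length). The parameter `strong` selects the variant, so that
both halves of the theory share their proofs. -/
def RaySemismoothAt (strong : Prop) (ψ : E → F) (x : E) : Prop :=
  ∃ (D : E → F) (K : ℝ≥0), LipschitzWith K D ∧ (∀ (t : ℝ) (h : E), 0 ≤ t → D (t • h) = t • D h) ∧
    RayNegligible strong (rayRemainder ψ x D)

/-- `ψ` is locally Lipschitz and (strongly) ray-semismooth at every point. -/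
def RaySemismooth (strong : Prop) (ψ : E → F) : Prop :=
  LocallyLipschitz ψ ∧ ∀ x, RaySemismoothAt strong ψ x

theorem eventually_rayFilter {P : E × ℝ → Prop} :
    (∀ᶠ p in rayFilter E, P p) ↔ ∀ᶠ h in 𝓝 (0 : E), ∀ r ∈ Icc (0 : ℝ) 1, P (h, r) :=
  eventually_prod_principal_iff

theorem tendsto_fst_rayFilter : Tendsto (fun p : E × ℝ => p.1) (rayFilter E) (𝓝 0) :=
  tendsto_fst

theorem tendsto_smul_rayFilter : Tendsto (fun p : E × ℝ => p.2 • p.1) (rayFilter E) (𝓝 0) := by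
  refine squeeze_zero_norm' ?_ (tendsto_norm_zero.comp (tendsto_fst_rayFilter (E := E)))
  rw [eventually_rayFilter]
  filter_upwards with h r hr
  simp only [norm_smul, Real.norm_eq_abs, abs_of_nonneg hr.1, Function.comp]
  exact mul_le_of_le_one_left (norm_nonneg _) hr.2

theorem isLittleO_rayFilter_iff {A : E × ℝ → F} :
    A =o[rayFilter E] (fun p => (1 - p.2) * ‖p.1‖) ↔
      ∀ ε > 0, ∀ᶠ h in 𝓝 (0 : E), ∀ r ∈ Icc (0 : ℝ) 1, ‖A (h, r)‖ ≤ ε * ((1 - r) * ‖h‖) := by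
  simp only [isLittleO_iff, eventually_rayFilter]
  refine forall₂_congr fun ε _ => eventually_congr (Eventually.of_forall fun h => ?_)
  refine forall₂_congr fun r hr => ?_
  rw [Real.norm_of_nonneg (mul_nonneg (sub_nonneg.2 hr.2) (norm_nonneg _))]

theorem isBigO_rayFilter_iff {A : E × ℝ → F} :
    A =O[rayFilter E] (fun p => (1 - p.2) * ‖p.1‖ ^ 2) ↔
      ∃ C, ∀ᶠ h in 𝓝 (0 : E), ∀ r ∈ Icc (0 : ℝ) 1, ‖A (h, r)‖ ≤ C * ((1 - r) * ‖h‖ ^ 2) := by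
  simp only [isBigO_iff, eventually_rayFilter]
  refine exists_congr fun ε => eventually_congr (Eventually.of_forall fun h => ?_)
  refine forall₂_congr fun r hr => ?_
  rw [Real.norm_of_nonneg (mul_nonneg (sub_nonneg.2 hr.2) (by positivity))]

namespace RayNegligible

variable {strong : Prop} {A B : E × ℝ → F}

theorem add (hA : RayNegligible strong A) (hB : RayNegligible strong B) :
    RayNegligible strong (fun p => A p + B p) :=
  ⟨hA.1.add hB.1, fun s => (hA.2 s).add (hB.2 s)⟩

theorem sub (hA : RayNegligible strong A) (hB : RayNegligible strong B) :
    RayNegligible strong (fun p => A p - B p) :=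
  ⟨hA.1.sub hB.1, fun s => (hA.2 s).sub (hB.2 s)⟩

theorem of_isBigO {B : E × ℝ → H} (hB : RayNegligible strong B) (h : A =O[rayFilter E] B) :
    RayNegligible strong A :=
  ⟨h.trans_isLittleO hB.1, fun s => h.trans (hB.2 s)⟩

/-- The bound at `r = 0` may be used for every `r`, at the cost of the factor `1 - r`. -/
theorem smul_at_zero (hA : RayNegligible strong A) :
    RayNegligible strong (fun p => (1 - p.2) • A (p.1, 0)) := by
  have h0 : (0 : ℝ) ∈ Icc (0 : ℝ) 1 := ⟨le_rfl, zero_le_one⟩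
  refine ⟨isLittleO_rayFilter_iff.2 fun ε hε => ?_, fun s => isBigO_rayFilter_iff.2 ?_⟩
  · filter_upwards [isLittleO_rayFilter_iff.1 hA.1 ε hε] with h hh r hr
    have := mul_le_mul_of_nonneg_left (hh 0 h0) (sub_nonneg.2 hr.2)
    rw [norm_smul, Real.norm_of_nonneg (sub_nonneg.2 hr.2)]
    exact this.trans_eq (by ring)
  · obtain ⟨C, hC⟩ := isBigO_rayFilter_iff.1 (hA.2 s)
    refine ⟨C, ?_⟩
    filter_upwards [hC] with h hh r hr
    have := mul_le_mul_of_nonneg_left (hh 0 h0) (sub_nonneg.2 hr.2)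
    rw [norm_smul, Real.norm_of_nonneg (sub_nonneg.2 hr.2)]
    exact this.trans_eq (by ring)

/-- Negligibility is preserved by a change of variables `h ↦ k h` with `k h = O(‖h‖)`. -/
theorem comp_fst {B : H × ℝ → F} (hB : RayNegligible strong B) {k : E → H}
    (hk : k =O[𝓝 0] (fun h : E => h)) :
    RayNegligible strong (fun p : E × ℝ => B (k p.1, p.2)) := by
  have hk0 : Tendsto k (𝓝 0) (𝓝 0) := hk.trans_tendsto tendsto_id
  have hT : Tendsto (fun p : E × ℝ => (k p.1, p.2)) (rayFilter E) (rayFilter H) :=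
    hk0.prodMap tendsto_id
  have hkf : (fun p : E × ℝ => ‖k p.1‖) =O[rayFilter E] (fun p => ‖p.1‖) :=
    (hk.comp_tendsto tendsto_fst_rayFilter).norm_norm
  refine ⟨(hB.1.comp_tendsto hT).trans_isBigO ?_, fun s => ((hB.2 s).comp_tendsto hT).trans ?_⟩
  · exact (isBigO_refl _ _).mul hkf
  · exact (isBigO_refl _ _).mul (hkf.pow 2)

end RayNegligible

theorem _root_.LocallyLipschitz.isBigO_sub {ψ : E → F} (hψ : LocallyLipschitz ψ)
    (x : E) {α : Type*} {l : Filter α} {a b : α → E} (ha : Tendsto a l (𝓝 x))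
    (hb : Tendsto b l (𝓝 x)) :
    (fun i => ψ (a i) - ψ (b i)) =O[l] (fun i => a i - b i) := by
  obtain ⟨K, U, hU, hK⟩ := hψ x
  refine IsBigO.of_bound K ?_
  filter_upwards [ha hU, hb hU] with i hai hbi
  exact hK.norm_sub_le hai hbi

theorem tendsto_add_left_nhds_zero (x : E) {α : Type*} {l : Filter α} {a : α → E}
    (ha : Tendsto a l (𝓝 0)) : Tendsto (fun i => x + a i) l (𝓝 x) := by
  simpa using tendsto_const_nhds.add ha

/-- Chain rule: ray-semismoothness is preserved by composition. The point `g (x + r h)` is compared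
with the point of the ray from `g x` to `g (x + h)` with the same parameter `r`. -/
theorem RaySemismoothAt.comp {strong : Prop} {f : F → H} {g : E → F} {x : E}
    (hf : RaySemismoothAt strong f (g x)) (hg : RaySemismoothAt strong g x)
    (hfL : LocallyLipschitz f) (hgL : LocallyLipschitz g) :
    RaySemismoothAt strong (fun y => f (g y)) x := by
  obtain ⟨Df, Kf, hDf, hDf', hRf⟩ := hf
  obtain ⟨Dg, Kg, hDg, hDg', hRg⟩ := hg
  refine ⟨fun h => Df (Dg h), Kf * Kg, hDf.comp hDg, fun t h ht => by
    simp only [hDg' t h ht, hDf' t _ ht], ?_⟩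
  set k : E → F := fun h => g (x + h) - g x with hkdef
  have hk : k =O[𝓝 0] (fun h : E => h) := by
    simpa using hgL.isBigO_sub x (tendsto_add_left_nhds_zero x tendsto_id)
      (tendsto_const_nhds (f := 𝓝 (0 : E)))
  have hk0 : Tendsto k (𝓝 0) (𝓝 0) := hk.trans_tendsto tendsto_id
  have hgt : Tendsto (fun p : E × ℝ => g (x + p.2 • p.1)) (rayFilter E) (𝓝 (g x)) :=
    (hgL.continuous.tendsto x).comp (tendsto_add_left_nhds_zero x tendsto_smul_rayFilter)
  have hkT : Tendsto (fun p : E × ℝ => (k p.1, p.2)) (rayFilter E) (rayFilter F) :=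
    hk0.prodMap tendsto_id
  have hyt : Tendsto (fun p : E × ℝ => g x + p.2 • k p.1) (rayFilter E) (𝓝 (g x)) :=
    tendsto_add_left_nhds_zero _ (tendsto_smul_rayFilter.comp hkT)
  have h0 := hRg.smul_at_zero
  have h1 := hRf.comp_fst hk
  have h2 : RayNegligible strong
      (fun p : E × ℝ => f (g x + p.2 • k p.1) - f (g (x + p.2 • p.1))) := by
    refine (hRg.sub h0).of_isBigO ((hfL.isBigO_sub _ hyt hgt).congr_right fun p => ?_)
    simp only [rayRemainder, hkdef, zero_smul, add_zero, sub_zero, one_smul]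
    module
  have h3 : RayNegligible strong (fun p : E × ℝ => (1 - p.2) • (Df (k p.1) - Df (Dg p.1))) := by
    refine h0.of_isBigO ((isBigO_refl (fun p : E × ℝ => 1 - p.2) _).smul
      (IsBigO.of_bound Kf (Eventually.of_forall fun p => ?_)))
    refine (hDf.norm_sub_le _ _).trans_eq ?_
    simp [rayRemainder, hkdef]
  convert (h1.add h2).add h3 using 2 with p
  simp only [rayRemainder, hkdef, add_sub_cancel]
  module

theorem RaySemismooth.comp {strong : Prop} {f : F → H} {g : E → F}
    (hf : RaySemismooth strong f) (hg : RaySemismooth strong g) :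
    RaySemismooth strong (fun y => f (g y)) :=
  ⟨hf.1.comp hg.1, fun x => (hf.2 (g x)).comp (hg.2 x) hf.1 hg.1⟩

theorem RaySemismoothAt.prodMk {strong : Prop} {f : E → F} {g : E → H} {x : E}
    (hf : RaySemismoothAt strong f x) (hg : RaySemismoothAt strong g x) :
    RaySemismoothAt strong (fun y => (f y, g y)) x := by
  obtain ⟨Df, Kf, hDf, hDf', hRf⟩ := hf
  obtain ⟨Dg, Kg, hDg, hDg', hRg⟩ := hg
  refine ⟨fun h => (Df h, Dg h), _, hDf.prodMk hDg, fun t h ht => by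
    simp [hDf' t h ht, hDg' t h ht], hRf.1.prod_left hRg.1,
    fun s => (hRf.2 s).prod_left (hRg.2 s)⟩

theorem RaySemismooth.prodMk {strong : Prop} {f : E → F} {g : E → H}
    (hf : RaySemismooth strong f) (hg : RaySemismooth strong g) :
    RaySemismooth strong (fun y => (f y, g y)) :=
  ⟨hf.1.prodMk hg.1, fun x => (hf.2 x).prodMk (hg.2 x)⟩

/-- A map which is differentiable near `x` with a derivative that is Lipschitz near `x` is strongly
ray-semismooth at `x`. -/
theorem RaySemismoothAt.of_lipschitzOnWith_fderiv (strong : Prop) {ψ : E → F} {x : E} {K : ℝ≥0}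
    {U : Set E} (hU : U ∈ 𝓝 x) (hd : ∀ y ∈ U, DifferentiableAt ℝ ψ y)
    (hK : LipschitzOnWith K (fderiv ℝ ψ) U) : RaySemismoothAt strong ψ x := by
  have hO : rayRemainder ψ x (fderiv ℝ ψ x) =O[rayFilter E] fun p => (1 - p.2) * ‖p.1‖ ^ 2 := by
    obtain ⟨ρ, hρ, hρU⟩ := Metric.mem_nhds_iff.1 hU
    refine isBigO_rayFilter_iff.2 ⟨K, ?_⟩
    filter_upwards [Metric.ball_mem_nhds (0 : E) hρ] with h hh r hr
    have hhρ : ‖h‖ < ρ := by simpa using hh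
    have hsub : Metric.closedBall x ‖h‖ ⊆ U :=
      (Metric.closedBall_subset_ball hhρ).trans hρU
    have hrh : ‖r • h‖ ≤ ‖h‖ := by
      rw [norm_smul, Real.norm_of_nonneg hr.1]
      exact mul_le_of_le_one_left (norm_nonneg _) hr.2
    have key := (convex_closedBall x ‖h‖).norm_image_sub_le_of_norm_fderiv_le'
      (𝕜 := ℝ) (f := ψ) (φ := fderiv ℝ ψ x) (C := K * ‖h‖) (x := x + r • h) (y := x + h)
      (fun y hy => hd y (hsub hy)) (fun y hy => ?_) (by simpa using hrh) (by simp)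
    · have e : x + h - (x + r • h) = (1 - r) • h := by module
      rw [e, map_smul, norm_smul, Real.norm_of_nonneg (sub_nonneg.2 hr.2)] at key
      exact key.trans_eq (by ring)
    · refine (hK.norm_sub_le (hsub hy) (mem_of_mem_nhds hU)).trans ?_
      gcongr
      simpa [dist_eq_norm] using hy
  refine ⟨fderiv ℝ ψ x, _, (fderiv ℝ ψ x).lipschitz, fun t h _ => map_smul _ _ _,
    hO.trans_isLittleO ?_, fun _ => hO⟩
  refine (isBigO_refl (fun p : E × ℝ => 1 - p.2) _).mul_isLittleO ?_
  simp_rw [pow_two]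
  have : (fun p : E × ℝ => ‖p.1‖) =o[rayFilter E] (fun _ => (1 : ℝ)) :=
    (isLittleO_one_iff ℝ).2 (tendsto_norm_zero.comp tendsto_fst_rayFilter)
  simpa using this.mul_isBigO (isBigO_refl (fun p : E × ℝ => ‖p.1‖) _)

theorem RaySemismooth.of_locallyLipschitz_fderiv (strong : Prop) {ψ : E → F}
    (hψ : ContDiff ℝ 1 ψ) (h : LocallyLipschitz (fderiv ℝ ψ)) : RaySemismooth strong ψ := by
  refine ⟨hψ.locallyLipschitz, fun x => ?_⟩
  obtain ⟨K, U, hU, hK⟩ := h x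
  exact .of_lipschitzOnWith_fderiv strong hU (fun y _ => hψ.differentiable one_ne_zero y) hK

theorem RaySemismoothAt.of_contDiffAt (strong : Prop) {ψ : E → F} {x : E}
    (hψ : ContDiffAt ℝ 2 ψ x) : RaySemismoothAt strong ψ x := by
  obtain ⟨K, U, hU, hK⟩ :=
    (hψ.fderiv_right (m := 1) (by norm_num)).exists_lipschitzOnWith
  have hd : {y | DifferentiableAt ℝ ψ y} ∈ 𝓝 x :=
    (hψ.eventually (by simp)).mono fun y hy => hy.differentiableAt two_ne_zero
  exact .of_lipschitzOnWith_fderiv strong (inter_mem hU hd) (fun y hy => hy.2)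
    (hK.mono inter_subset_left)

theorem RaySemismooth.of_contDiff (strong : Prop) {ψ : E → F} (hψ : ContDiff ℝ 2 ψ) :
    RaySemismooth strong ψ :=
  ⟨(hψ.of_le one_le_two).locallyLipschitz, fun _ => .of_contDiffAt strong hψ.contDiffAt⟩

theorem RaySemismooth.clm_apply {strong : Prop} (A : F →L[ℝ] H) {ψ : E → F}
    (hψ : RaySemismooth strong ψ) : RaySemismooth strong (fun x => A (ψ x)) :=
  (RaySemismooth.of_contDiff strong A.contDiff).comp hψ

theorem RaySemismooth.comp_clm {strong : Prop} {ψ : F → H}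
    (hψ : RaySemismooth strong ψ) (A : E →L[ℝ] F) : RaySemismooth strong (fun x => ψ (A x)) :=
  hψ.comp (RaySemismooth.of_contDiff strong A.contDiff)

theorem RaySemismooth.const (strong : Prop) (c : F) : RaySemismooth strong (fun _ : E => c) :=
  RaySemismooth.of_contDiff strong contDiff_const

theorem RaySemismooth.add {strong : Prop} {f g : E → F} (hf : RaySemismooth strong f)
    (hg : RaySemismooth strong g) : RaySemismooth strong (fun x => f x + g x) :=
  (RaySemismooth.of_contDiff strong contDiff_add).comp (hf.prodMk hg)

theorem RaySemismooth.neg {strong : Prop} {f : E → F} (hf : RaySemismooth strong f) :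
    RaySemismooth strong (fun x => -f x) :=
  (RaySemismooth.of_contDiff strong contDiff_neg).comp hf

theorem RaySemismooth.smul {strong : Prop} {f : E → ℝ} {g : E → F} (hf : RaySemismooth strong f)
    (hg : RaySemismooth strong g) : RaySemismooth strong (fun x => f x • g x) :=
  (RaySemismooth.of_contDiff strong contDiff_smul).comp (hf.prodMk hg)

theorem RaySemismooth.sum {strong : Prop} {ι : Type*} {s : Finset ι} {f : ι → E → F}
    (hf : ∀ i ∈ s, RaySemismooth strong (f i)) :
    RaySemismooth strong (fun x => ∑ i ∈ s, f i x) := by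
  classical
  induction s using Finset.induction_on with
  | empty => simpa using RaySemismooth.const strong (0 : F)
  | insert a s ha ih =>
    simp only [Finset.sum_insert ha]
    exact (hf a (Finset.mem_insert_self a s)).add
      (ih fun i hi => hf i (Finset.mem_insert_of_mem hi))

/-- A norm that comes from an inner product is strongly ray-semismooth: it is positively homogeneous
at the origin and smooth elsewhere. -/
theorem raySemismooth_norm (strong : Prop) {V : Type*} [NormedAddCommGroup V]
    [InnerProductSpace ℝ V] : RaySemismooth strong (fun v : V => ‖v‖) := by
  refine ⟨lipschitzWith_one_norm.locallyLipschitz, fun x => ?_⟩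
  rcases eq_or_ne x 0 with rfl | hx
  · refine ⟨norm, 1, lipschitzWith_one_norm, fun t h ht => by
      rw [norm_smul, Real.norm_of_nonneg ht, smul_eq_mul], ?_⟩
    have hz : rayRemainder (fun v : V => ‖v‖) 0 norm =ᶠ[rayFilter V] fun _ => (0 : ℝ) := by
      refine eventually_rayFilter.2 (Eventually.of_forall fun h r hr => ?_)
      simp only [rayRemainder, zero_add, norm_smul, Real.norm_of_nonneg hr.1, smul_eq_mul]
      ring
    exact ⟨(isLittleO_zero _ _).congr' hz.symm .rfl, fun _ =>
      (isBigO_zero _ _).congr' hz.symm .rfl⟩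
  · exact .of_contDiffAt strong (contDiffAt_norm ℝ hx)

end RayRemainder

/-! ### From ray-semismoothness to generalized Jacobians -/

section Clarke

variable {E F : Type*} [NormedAddCommGroup E] [NormedSpace ℝ E]
  [NormedAddCommGroup F] [NormedSpace ℝ F]

/-- A Jacobian at `x + h` is tested against `h` by letting `r → 1` in the remainder. -/
theorem norm_fderiv_sub_le_of_rayRemainder {ψ : E → F} {x h : E} {D : E → F} {c : ℝ}
    (hd : DifferentiableAt ℝ ψ (x + h))
    (hc : ∀ r ∈ Icc (0 : ℝ) 1, ‖rayRemainder ψ x D (h, r)‖ ≤ c * (1 - r)) :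
    ‖fderiv ℝ ψ (x + h) h - D h‖ ≤ c := by
  have hline : HasDerivAt (fun r : ℝ => ψ (x + r • h)) (fderiv ℝ ψ (x + h) h) 1 := by
    have h1 : HasDerivAt (fun r : ℝ => x + r • h) h 1 := by
      simpa using ((hasDerivAt_id (1 : ℝ)).smul_const h).const_add x
    have h2 : HasFDerivAt ψ (fderiv ℝ ψ (x + h)) (x + (1 : ℝ) • h) := by
      simpa using hd.hasFDerivAt
    exact h2.comp_hasDerivAt (1 : ℝ) h1
  have hs : Tendsto (fun r : ℝ => slope (fun r : ℝ => ψ (x + r • h)) 1 r - D h) (𝓝[<] 1)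
      (𝓝 (fderiv ℝ ψ (x + h) h - D h)) :=
    ((hasDerivAt_iff_tendsto_slope.1 hline).mono_left
      (nhdsWithin_mono _ fun r hr => ne_of_lt hr)).sub_const _
  refine le_of_tendsto hs.norm ?_
  filter_upwards [Ioo_mem_nhdsLT (zero_lt_one (α := ℝ))] with r hr
  have hr1 : 0 < 1 - r := sub_pos.2 hr.2
  have e : slope (fun r : ℝ => ψ (x + r • h)) 1 r - D h
      = (1 - r)⁻¹ • rayRemainder ψ x D (h, r) := by
    have e1 : (r - 1)⁻¹ = -(1 - r)⁻¹ := by rw [← neg_sub, inv_neg]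
    simp only [slope_def_module, rayRemainder, one_smul, e1, smul_sub, smul_smul,
      inv_mul_cancel₀ hr1.ne']
    module
  rw [e, norm_smul, Real.norm_of_nonneg (inv_nonneg.2 hr1.le), inv_mul_le_iff₀ hr1, mul_comm]
  exact hc r ⟨hr.1.le, hr.2.le⟩

/-- An estimate at the points of differentiability passes to the generalized Jacobian, which is
obtained from them by limits and convex combinations. -/
theorem norm_clarkeJacobian_sub_le {ψ : E → F} {x : E} {D : E → F} (hD : Continuous D)
    {b : E → ℝ} (hb : Continuous b) {U : Set E} (hU : IsOpen U)
    (hc : ∀ h ∈ U, DifferentiableAt ℝ ψ (x + h) → ‖fderiv ℝ ψ (x + h) h - D h‖ ≤ b h)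
    {h : E} (hh : h ∈ U) {V : E →L[ℝ] F} (hV : V ∈ clarkeJacobian ψ (x + h)) :
    ‖V h - D h‖ ≤ b h := by
  suffices hsub : clarkeJacobian ψ (x + h) ⊆ {V | ‖V h - D h‖ ≤ b h} from hsub hV
  refine convexHull_min ?_ ?_
  · rintro V ⟨u, hu, hd, hlim⟩
    have hh' : Tendsto (fun k => u k - x) atTop (𝓝 h) := by
      simpa using hu.sub_const x
    have hl : Tendsto (fun k => ‖fderiv ℝ ψ (u k) (u k - x) - D (u k - x)‖) atTop
        (𝓝 ‖V h - D h‖) :=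
      (((isBoundedBilinearMap_apply.continuous.tendsto (V, h)).comp
        (hlim.prodMk_nhds hh')).sub ((hD.tendsto h).comp hh')).norm
    refine le_of_tendsto_of_tendsto hl ((hb.tendsto h).comp hh') ?_
    filter_upwards [hh' (hU.mem_nhds hh)] with k hk
    have := hc (u k - x) hk
    rw [add_sub_cancel] at this
    exact this (hd k)
  · have : {V : E →L[ℝ] F | ‖V h - D h‖ ≤ b h}
        = (ContinuousLinearMap.apply ℝ F h).toLinearMap ⁻¹' Metric.closedBall (D h) (b h) := by
      ext V
      simp [dist_eq_norm]
    rw [this]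
    exact (convex_closedBall _ _).linear_preimage _

/-- The case `r = 0` of the remainder estimate says that `D` is the directional derivative. -/
theorem RayNegligible.hasDirDeriv {strong : Prop} {ψ : E → F} {x : E} {D : E → F}
    (hD : ∀ (t : ℝ) (h : E), 0 ≤ t → D (t • h) = t • D h)
    (hR : RayNegligible strong (rayRemainder ψ x D)) (d : E) : HasDirDeriv ψ x d (D d) := by
  rw [HasDirDeriv, tendsto_iff_norm_sub_tendsto_zero]
  refine (Metric.tendsto_nhds).2 fun ε hε => ?_
  have hd : 0 < ‖d‖ + 1 := by positivity
  have h1 := isLittleO_rayFilter_iff.1 hR.1 (ε / (‖d‖ + 1)) (by positivity)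
  have ht : Tendsto (fun t : ℝ => t • d) (𝓝[>] 0) (𝓝 0) := by
    have : Continuous fun t : ℝ => t • d := by fun_prop
    simpa using (this.tendsto 0).mono_left nhdsWithin_le_nhds
  filter_upwards [ht.eventually h1, self_mem_nhdsWithin] with t h2 (ht0 : 0 < t)
  have h3 := h2 0 ⟨le_rfl, zero_le_one⟩
  simp only [rayRemainder, hD t d ht0.le, zero_smul, add_zero, sub_zero, one_smul, one_mul,
    norm_smul, Real.norm_of_nonneg ht0.le] at h3
  have e : t⁻¹ • (ψ (x + t • d) - ψ x) - D d = t⁻¹ • (ψ (x + t • d) - ψ x - t • D d) := by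
    rw [smul_sub _ _ (t • D d), smul_smul, inv_mul_cancel₀ ht0.ne', one_smul]
  rw [Real.dist_eq, sub_zero, abs_norm, e, norm_smul, Real.norm_of_nonneg (inv_nonneg.2 ht0.le),
    inv_mul_lt_iff₀ ht0]
  refine h3.trans_lt ?_
  rw [show ε / (‖d‖ + 1) * (t * ‖d‖) = t * (ε * (‖d‖ / (‖d‖ + 1))) by ring]
  gcongr
  refine mul_lt_of_lt_one_right hε ?_
  rw [div_lt_one hd]
  linarith

theorem RaySemismoothAt.isSemismoothAt {strong : Prop} {ψ : E → F} {x : E}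
    (hx : RaySemismoothAt strong ψ x) (hψ : LocallyLipschitz ψ) : IsSemismoothAt ψ x := by
  refine ⟨hψ, fun d => ?_⟩
  obtain ⟨D, K, hDK, hD, hR⟩ := hx
  refine ⟨D d, fun ε hε => ?_⟩
  set c := ε / (2 * (‖d‖ + 1)) with hcdef
  have hd : 0 < ‖d‖ + 1 := by positivity
  have hc : 0 < c := by positivity
  obtain ⟨ρ, hρ, hball⟩ := Metric.eventually_nhds_iff_ball.1 (isLittleO_rayFilter_iff.1 hR.1 c hc)
  have hV : ∀ h ∈ Metric.ball (0 : E) ρ, ∀ V ∈ clarkeJacobian ψ (x + h),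
      ‖V h - D h‖ ≤ c * ‖h‖ := fun h hh V hV =>
    norm_clarkeJacobian_sub_le hDK.continuous (b := fun h => c * ‖h‖) (by fun_prop)
      Metric.isOpen_ball (fun h hh hdiff => norm_fderiv_sub_le_of_rayRemainder hdiff
        fun r hr => (hball h hh r hr).trans_eq (by ring)) hh hV
  refine ⟨min (min 1 (ρ / (‖d‖ + 1))) (ε / (2 * (K + 1))), by positivity, ?_⟩
  intro d' t hd' ht0 ht V hVmem
  have hd1 : ‖d' - d‖ < 1 := hd'.trans_le ((min_le_left _ _).trans (min_le_left _ _))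
  have hd2 : ‖d' - d‖ < ε / (2 * (K + 1)) := hd'.trans_le (min_le_right _ _)
  have ht1 : t < ρ / (‖d‖ + 1) := ht.trans_le ((min_le_left _ _).trans (min_le_right _ _))
  have hd'n : ‖d'‖ < ‖d‖ + 1 := by
    have := norm_le_norm_add_norm_sub' d' d
    linarith
  have htn : ‖t • d'‖ = t * ‖d'‖ := by rw [norm_smul, Real.norm_of_nonneg ht0.le]
  have hmem : t • d' ∈ Metric.ball (0 : E) ρ := by
    rw [mem_ball_zero_iff, htn]
    calc t * ‖d'‖ ≤ t * (‖d‖ + 1) := by gcongr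
      _ < ρ := by rwa [← lt_div_iff₀ hd]
  have h1 := hV _ hmem V hVmem
  rw [map_smul, hD t d' ht0.le, ← smul_sub, norm_smul, Real.norm_of_nonneg ht0.le, htn,
    mul_left_comm, mul_le_mul_iff_right₀ ht0] at h1
  have h2 : c * ‖d'‖ ≤ ε / 2 := by
    calc c * ‖d'‖ ≤ c * (‖d‖ + 1) := by gcongr
      _ = ε / 2 := by rw [hcdef]; field_simp
  have h3 : ‖D d' - D d‖ < ε / 2 := by
    refine (hDK.norm_sub_le _ _).trans_lt ?_
    calc (K : ℝ) * ‖d' - d‖ ≤ (K + 1) * ‖d' - d‖ := by gcongr; linarith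
      _ < (K + 1) * (ε / (2 * (K + 1))) := by gcongr
      _ = ε / 2 := by field_simp
  calc ‖V d' - D d‖ ≤ ‖V d' - D d'‖ + ‖D d' - D d‖ := norm_sub_le_norm_sub_add_norm_sub _ _ _
    _ < ε := by linarith

theorem RaySemismooth.isSemismooth {strong : Prop} {ψ : E → F} (hψ : RaySemismooth strong ψ) :
    IsSemismooth ψ := fun x => (hψ.2 x).isSemismoothAt hψ.1

theorem RaySemismooth.isStronglySemismooth {ψ : E → F} (hψ : RaySemismooth True ψ) :
    IsStronglySemismooth ψ := by
  intro x
  refine ⟨(hψ.2 x).isSemismoothAt hψ.1, ?_⟩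
  obtain ⟨D, K, hDK, hD, hR⟩ := hψ.2 x
  obtain ⟨C, hC⟩ := isBigO_rayFilter_iff.1 (hR.2 trivial)
  obtain ⟨ρ, hρ, hball⟩ := Metric.eventually_nhds_iff_ball.1 hC
  refine ⟨D, hR.hasDirDeriv hD, C, ρ, hρ, fun d hd V hV => ?_⟩
  exact norm_clarkeJacobian_sub_le hDK.continuous (b := fun h => C * ‖h‖ ^ 2) (by fun_prop)
      Metric.isOpen_ball (fun h hh hdiff => norm_fderiv_sub_le_of_rayRemainder hdiff
        fun r hr => (hball h hh r hr).trans_eq (by ring)) (mem_ball_zero_iff.2 hd) hV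

end Clarke

/-! ### From generalized Jacobians to ray-semismoothness -/

section Rademacher

open MeasureTheory

variable {E F : Type*} [NormedAddCommGroup E] [NormedSpace ℝ E] [FiniteDimensional ℝ E]
  [NormedAddCommGroup F] [NormedSpace ℝ F] [FiniteDimensional ℝ F]

/-- Rademacher's theorem for locally Lipschitz maps. -/
theorem _root_.LocallyLipschitz.ae_differentiableAt [MeasurableSpace E] [BorelSpace E]
    {ψ : E → F} (hψ : LocallyLipschitz ψ) (μ : Measure E) [μ.IsAddHaarMeasure] :
    ∀ᵐ x ∂μ, DifferentiableAt ℝ ψ x := by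
  have h : ∀ n : ℕ, ∀ᵐ x ∂μ, x ∈ Metric.ball (0 : E) n → DifferentiableAt ℝ ψ x := by
    intro n
    have := FiniteDimensional.proper_real E
    obtain ⟨K, hK⟩ := (hψ.locallyLipschitzOn (s := Metric.closedBall (0 : E) n)
      ).exists_lipschitzOnWith_of_compact (isCompact_closedBall _ _)
    filter_upwards [(hK.mono Metric.ball_subset_closedBall).ae_differentiableWithinAt_of_mem
      (μ := μ)] with x hx hxn
    exact (hx hxn).differentiableAt (Metric.isOpen_ball.mem_nhds hxn)
  filter_upwards [ae_all_iff.2 h] with x hx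
  obtain ⟨n, hn⟩ := exists_nat_gt ‖x‖
  exact hx n (mem_ball_zero_iff.2 hn)

/-- By Fubini's theorem, a locally Lipschitz map is differentiable at almost every point of almost
every ray issued from a given point. -/
theorem ae_ae_differentiableAt_ray [MeasurableSpace E] [BorelSpace E]
    {ψ : E → F} (hψ : LocallyLipschitz ψ) (x : E) (μ : Measure E) [μ.IsAddHaarMeasure] :
    ∀ᵐ d ∂μ, ∀ᵐ s : ℝ, DifferentiableAt ℝ ψ (x + s • d) := by
  have hm : MeasurableSet {p : E × ℝ | DifferentiableAt ℝ ψ (x + p.2 • p.1)} := by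
    have : Measurable fun p : E × ℝ => x + p.2 • p.1 := by fun_prop
    exact this (measurableSet_of_differentiableAt ℝ ψ)
  rw [Measure.ae_ae_comm (p := fun (d : E) (s : ℝ) => DifferentiableAt ℝ ψ (x + s • d)) hm]
  have h0 : ∀ᵐ s : ℝ, s ≠ 0 := by simp [ae_iff]
  filter_upwards [h0] with s hs
  have h1 : ∀ᵐ y ∂μ, DifferentiableAt ℝ ψ (x + y) := by
    have := (measurePreserving_add_left μ x).quasiMeasurePreserving.ae (hψ.ae_differentiableAt μ)
    simpa using this
  have h2 : Measure.QuasiMeasurePreserving (fun d : E => s • d) μ μ := by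
    refine ⟨measurable_const_smul s, ?_⟩
    rw [Measure.map_addHaar_smul μ hs]
    exact Measure.smul_absolutelyContinuous
  exact h2.ae h1

/-- Mean value inequality for a Lipschitz curve whose derivative is bounded almost everywhere. -/
theorem norm_sub_le_of_ae_norm_deriv_le {γ : ℝ → F} {K : ℝ≥0} {a b c : ℝ} (hab : a ≤ b)
    (hγ : LipschitzOnWith K γ (Icc a b))
    (hd : ∀ᵐ s, s ∈ Ioo a b → ∃ v, HasDerivAt γ v s ∧ ‖v‖ ≤ c) : ‖γ b - γ a‖ ≤ c * (b - a) := by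
  obtain ⟨φ, hφ, hφv⟩ := exists_dual_vector'' ℝ (γ b - γ a)
  have hL : AbsolutelyContinuousOnInterval (fun s => φ (γ s)) a b := by
    have := (φ.lipschitz.comp_lipschitzOnWith hγ)
    rw [← uIcc_of_le hab] at this
    exact this.absolutelyContinuousOnInterval
  have hI := hL.integral_deriv_eq_sub
  rw [← map_sub, hφv] at hI
  have hle : ‖∫ s in a..b, deriv (fun s => φ (γ s)) s‖ ≤ c * |b - a| := by
    refine intervalIntegral.norm_integral_le_of_norm_le_const_ae ?_
    have hb : ∀ᵐ s : ℝ, s ≠ b := by simp [ae_iff]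
    filter_upwards [hd, hb] with s hs hsb hmem
    rw [uIoc_of_le hab] at hmem
    obtain ⟨v, hv, hvc⟩ := hs ⟨hmem.1, lt_of_le_of_ne hmem.2 hsb⟩
    have : HasDerivAt (fun s => φ (γ s)) (φ v) s := φ.hasFDerivAt.comp_hasDerivAt s hv
    rw [this.deriv]
    refine (φ.le_opNorm v).trans ?_
    exact (mul_le_of_le_one_left (norm_nonneg v) hφ).trans hvc
  rw [hI, abs_of_nonneg (sub_nonneg.2 hab)] at hle
  simpa using hle

/-- If the generalized Jacobians near `x`, around the direction `d`, send directions close to `d`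
to vectors close to `L`, then increments of `ψ` along the corresponding rays are predicted
by `L`. -/
theorem norm_ray_increment_sub_le {ψ : E → F} (hψ : LocallyLipschitz ψ) {x d : E} {L : F}
    {ε δ : ℝ} (H : ∀ (d' : E) (t : ℝ), ‖d' - d‖ < δ → 0 < t → t < δ →
      ∀ V ∈ clarkeJacobian ψ (x + t • d'), ‖V d' - L‖ < ε)
    {d' : E} (hd' : ‖d' - d‖ < δ) {a b : ℝ} (ha : 0 ≤ a) (hab : a ≤ b) (hb : b < δ) :
    ‖ψ (x + b • d') - ψ (x + a • d') - (b - a) • L‖ ≤ ε * (b - a) := by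
  borelize E
  set μ : Measure E := Measure.addHaar
  set S : Set E := {e | ‖ψ (x + b • e) - ψ (x + a • e) - (b - a) • L‖ ≤ ε * (b - a)} with hS
  have hSc : IsClosed S := by
    have := hψ.continuous
    exact isClosed_le (by fun_prop) (by fun_prop)
  -- The estimate holds for almost every direction close to `d`, hence for all of them.
  have hae : ∀ᵐ e ∂μ, e ∈ Metric.ball d δ → e ∈ S := by
    filter_upwards [ae_ae_differentiableAt_ray hψ x μ] with e he hed
    have hlin : LocallyLipschitz fun s : ℝ => ψ (x + s • e) - s • L := by
      have h1 : ContDiff ℝ 1 fun s : ℝ => x + s • e := by fun_prop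
      have h2 : ContDiff ℝ 1 fun p : F × ℝ => p.1 - p.2 • L := by fun_prop
      exact h2.locallyLipschitz.comp ((hψ.comp h1.locallyLipschitz).prodMk LocallyLipschitz.id)
    obtain ⟨K, hK⟩ := (hlin.locallyLipschitzOn (s := Icc a b)
      ).exists_lipschitzOnWith_of_compact isCompact_Icc
    have key := norm_sub_le_of_ae_norm_deriv_le (c := ε) hab hK ?_
    · rw [hS, mem_ofPred_eq]
      convert key using 2
      module
    · filter_upwards [he] with s hs hsab
      refine ⟨fderiv ℝ ψ (x + s • e) e - L, ?_, ?_⟩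
      · have h1 : HasDerivAt (fun s : ℝ => x + s • e) e s := by
          simpa using ((hasDerivAt_id s).smul_const e).const_add x
        have h2 : HasDerivAt (fun s : ℝ => s • L) L s := by
          simpa using (hasDerivAt_id s).smul_const L
        exact (hs.hasFDerivAt.comp_hasDerivAt s h1).sub h2
      · refine (H e s ?_ (ha.trans_lt hsab.1) (hsab.2.trans hb) _ ?_).le
        · simpa [dist_eq_norm] using hed
        · exact subset_convexHull ℝ _ ⟨fun _ => x + s • e, tendsto_const_nhds, fun _ => hs,
            tendsto_const_nhds⟩
  have hdense : Dense {e | e ∈ Metric.ball d δ → e ∈ S} := μ.dense_of_ae hae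
  have hmem : d' ∈ closure (Metric.ball d δ ∩ {e | e ∈ Metric.ball d δ → e ∈ S}) :=
    hdense.open_subset_closure_inter Metric.isOpen_ball (by simpa [dist_eq_norm] using hd')
  exact hSc.closure_subset_iff.2 (fun e he => he.2 he.1) hmem

/-- A directional derivative of a map which is Lipschitz near `x` is positively homogeneous and
Lipschitz in the direction. -/
theorem HasDirDeriv.lipschitzWith_and_smul {ψ : E → F} {x : E} {D : E → F} {K : ℝ≥0} {U : Set E}
    (hU : U ∈ 𝓝 x) (hK : LipschitzOnWith K ψ U) (hD : ∀ d, HasDirDeriv ψ x d (D d)) :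
    LipschitzWith K D ∧ ∀ (t : ℝ) (h : E), 0 ≤ t → D (t • h) = t • D h := by
  have hray : ∀ d : E, Tendsto (fun t : ℝ => x + t • d) (𝓝[>] 0) (𝓝 x) := fun d => by
    have : Continuous fun t : ℝ => x + t • d := by fun_prop
    simpa using (this.tendsto 0).mono_left nhdsWithin_le_nhds
  constructor
  · refine LipschitzWith.of_dist_le_mul fun d e => ?_
    rw [dist_eq_norm, dist_eq_norm]
    refine le_of_tendsto ((hD d).sub (hD e)).norm ?_
    filter_upwards [hray d hU, hray e hU, self_mem_nhdsWithin] with t h1 h2 (ht : 0 < t)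
    rw [← smul_sub, sub_sub_sub_cancel_right, norm_smul, Real.norm_of_nonneg (inv_nonneg.2 ht.le),
      inv_mul_le_iff₀ ht]
    refine (hK.norm_sub_le h1 h2).trans_eq ?_
    rw [add_sub_add_left_eq_sub, ← smul_sub, norm_smul, Real.norm_of_nonneg ht.le]
    ring
  · intro t h ht
    rcases ht.eq_or_lt with rfl | ht
    · have := hD ((0 : ℝ) • h)
      rw [zero_smul] at this ⊢
      refine tendsto_nhds_unique this ?_
      simp
    · have h1 : Tendsto (fun s : ℝ => s * t) (𝓝[>] 0) (𝓝[>] 0) := by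
        refine tendsto_nhdsWithin_iff.2 ⟨?_, ?_⟩
        · have : Continuous fun s : ℝ => s * t := by fun_prop
          simpa using (this.tendsto 0).mono_left nhdsWithin_le_nhds
        · filter_upwards [self_mem_nhdsWithin] with s (hs : 0 < s) using mul_pos hs ht
      refine tendsto_nhds_unique (hD (t • h)) ((((hD h).comp h1).const_smul t).congr fun s => ?_)
      simp only [Function.comp, smul_smul, mul_inv]
      rw [mul_comm s⁻¹, ← mul_assoc, mul_inv_cancel₀ ht.ne', one_mul]

/-- In finite dimensions, a semismooth map is ray-semismooth, with the limits that define
semismoothness as values of `D`. -/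
theorem IsSemismoothAt.raySemismoothAt {ψ : E → F} {x : E} (h : IsSemismoothAt ψ x) :
    RaySemismoothAt False ψ x := by
  obtain ⟨hψ, hlim⟩ := h
  choose D hD using hlim
  have hdir : ∀ d, HasDirDeriv ψ x d (D d) := by
    intro d
    refine Metric.tendsto_nhds.2 fun ε hε => ?_
    obtain ⟨δ, hδ, H⟩ := hD d (ε / 2) (half_pos hε)
    filter_upwards [Ioo_mem_nhdsGT hδ] with t ht
    have h1 := norm_ray_increment_sub_le hψ H (d' := d) (by simpa using hδ) le_rfl ht.1.le ht.2
    rw [zero_smul, add_zero, sub_zero] at h1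
    have e : t⁻¹ • (ψ (x + t • d) - ψ x) - D d = t⁻¹ • (ψ (x + t • d) - ψ x - t • D d) := by
      rw [smul_sub _ _ (t • D d), smul_smul, inv_mul_cancel₀ ht.1.ne', one_smul]
    rw [dist_eq_norm, e, norm_smul, Real.norm_of_nonneg (inv_nonneg.2 ht.1.le),
      inv_mul_lt_iff₀ ht.1]
    nlinarith [mul_pos ht.1 hε]
  obtain ⟨K, U, hU, hK⟩ := hψ x
  obtain ⟨hDK, hDs⟩ := HasDirDeriv.lipschitzWith_and_smul hU hK hdir
  refine ⟨D, K, hDK, hDs, isLittleO_rayFilter_iff.2 fun ε hε => ?_, False.elim⟩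
  have := FiniteDimensional.proper_real E
  -- Compactness of the unit sphere makes the estimate uniform in the direction.
  have huni : ∀ᶠ t : ℝ in 𝓝 0, ∀ d ∈ Metric.sphere (0 : E) 1, ∀ r ∈ Icc (0 : ℝ) 1, 0 ≤ t →
      ‖ψ (x + t • d) - ψ (x + (r * t) • d) - (t - r * t) • D d‖ ≤ ε * (t - r * t) := by
    refine (isCompact_sphere (0 : E) 1).eventually_forall_of_forall_eventually fun d _ => ?_
    obtain ⟨δ, hδ, H⟩ := hD d (ε / 2) (half_pos hε)
    have hcl : ∀ᶠ e in 𝓝 d, ‖D d - D e‖ < ε / 2 := by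
      have := (hDK.continuous.tendsto d).const_sub (D d)
      rw [sub_self] at this
      filter_upwards [this (Metric.ball_mem_nhds 0 (half_pos hε))] with e he
      simpa using he
    have hδ' : ∀ᶠ t : ℝ in 𝓝 0, |t| < δ := by
      filter_upwards [Metric.ball_mem_nhds (0 : ℝ) hδ] with t ht
      simpa using ht
    have hdd : ∀ᶠ e in 𝓝 d, ‖e - d‖ < δ := by
      filter_upwards [Metric.ball_mem_nhds d hδ] with e he
      simpa [dist_eq_norm] using he
    rw [nhds_prod_eq]
    filter_upwards [hδ'.prod_mk (hcl.and hdd)] with p hp r hr ht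
    obtain ⟨hpt, hpD, hpd⟩ := hp
    have hpt' : p.1 < δ := (le_abs_self _).trans_lt hpt
    have hrt : r * p.1 ≤ p.1 := mul_le_of_le_one_left ht hr.2
    have h1 := norm_ray_increment_sub_le hψ H (d' := p.2) hpd
      (mul_nonneg hr.1 ht) hrt hpt'
    have h2 : ‖(p.1 - r * p.1) • (D d - D p.2)‖ ≤ (p.1 - r * p.1) * (ε / 2) := by
      rw [norm_smul, Real.norm_of_nonneg (sub_nonneg.2 hrt)]
      exact mul_le_mul_of_nonneg_left hpD.le (sub_nonneg.2 hrt)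
    have e : ψ (x + p.1 • p.2) - ψ (x + (r * p.1) • p.2) - (p.1 - r * p.1) • D p.2
        = (ψ (x + p.1 • p.2) - ψ (x + (r * p.1) • p.2) - (p.1 - r * p.1) • D d)
          + (p.1 - r * p.1) • (D d - D p.2) := by module
    rw [e]
    refine (norm_add_le _ _).trans ((add_le_add h1 h2).trans_eq (by ring))
  have hn : Tendsto (fun h : E => ‖h‖) (𝓝 0) (𝓝 0) := by
    simpa using (continuous_norm (E := E)).tendsto 0
  filter_upwards [hn.eventually huni] with h hh r hr
  rcases eq_or_ne h 0 with rfl | h0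
  · have hD0 : D 0 = 0 := by simpa using hDs 0 0 le_rfl
    simp [rayRemainder, hD0]
  · have hh0 : ‖h‖ ≠ 0 := norm_ne_zero_iff.2 h0
    have hsph : ‖h‖⁻¹ • h ∈ Metric.sphere (0 : E) 1 := by
      simp [norm_smul, hh0]
    have h1 := hh _ hsph r hr (norm_nonneg h)
    rw [smul_smul, smul_smul, mul_inv_cancel₀ hh0, mul_assoc, mul_inv_cancel₀ hh0, one_smul,
      mul_one, hDs _ _ (inv_nonneg.2 (norm_nonneg h)), smul_smul, sub_mul, mul_assoc,
      mul_inv_cancel₀ hh0, mul_one] at h1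
    rw [rayRemainder]
    exact h1.trans_eq (by ring)

theorem IsSemismooth.raySemismooth {ψ : E → F} (h : IsSemismooth ψ) : RaySemismooth False ψ :=
  ⟨(h 0).1, fun x => (h x).raySemismoothAt⟩

end Rademacher

/-! ### Functions with ray-semismooth derivative -/

section RaySmooth

variable {E F : Type*} [NormedAddCommGroup E] [NormedSpace ℝ E]
  [NormedAddCommGroup F] [NormedSpace ℝ F]

/-- A real-valued `C¹` function whose derivative is (strongly) ray-semismooth. -/
def RaySmooth (strong : Prop) (ψ : E → ℝ) : Prop :=
  ContDiff ℝ 1 ψ ∧ RaySemismooth strong (fderiv ℝ ψ)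

namespace RaySmooth

variable {strong : Prop} {φ ψ : E → ℝ}

theorem differentiable (hψ : RaySmooth strong ψ) : Differentiable ℝ ψ :=
  hψ.1.differentiable one_ne_zero

/-- The derivative is locally Lipschitz, so the function itself is even strongly ray-semismooth. -/
theorem raySemismooth (hψ : RaySmooth strong ψ) : RaySemismooth strong ψ :=
  .of_locallyLipschitz_fderiv strong hψ.1 hψ.2.1

theorem of_clm (strong : Prop) (A : E →L[ℝ] ℝ) : RaySmooth strong (fun x => A x) := by
  refine ⟨A.contDiff, ?_⟩
  have : fderiv ℝ (fun x => A x) = fun _ => A := funext fun x => A.fderiv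
  rw [this]
  exact .const strong A

theorem add (hφ : RaySmooth strong φ) (hψ : RaySmooth strong ψ) :
    RaySmooth strong (fun x => φ x + ψ x) := by
  refine ⟨hφ.1.add hψ.1, ?_⟩
  have : fderiv ℝ (fun x => φ x + ψ x) = fun x => fderiv ℝ φ x + fderiv ℝ ψ x :=
    funext fun x => fderiv_fun_add (hφ.differentiable x) (hψ.differentiable x)
  rw [this]
  exact hφ.2.add hψ.2

theorem mul (hφ : RaySmooth strong φ) (hψ : RaySmooth strong ψ) :
    RaySmooth strong (fun x => φ x * ψ x) := by
  refine ⟨hφ.1.mul hψ.1, ?_⟩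
  have : fderiv ℝ (fun x => φ x * ψ x) = fun x => φ x • fderiv ℝ ψ x + ψ x • fderiv ℝ φ x :=
    funext fun x => fderiv_fun_mul (hφ.differentiable x) (hψ.differentiable x)
  rw [this]
  exact (hφ.raySemismooth.smul hψ.2).add (hψ.raySemismooth.smul hφ.2)

theorem const (strong : Prop) (c : ℝ) : RaySmooth strong (fun _ : E => c) := by
  refine ⟨contDiff_const, ?_⟩
  rw [fderiv_fun_const]
  exact .const strong (0 : E →L[ℝ] ℝ)

theorem const_mul (c : ℝ) (hψ : RaySmooth strong ψ) : RaySmooth strong (fun x => c * ψ x) :=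
  (const strong c).mul hψ

theorem sub (hφ : RaySmooth strong φ) (hψ : RaySmooth strong ψ) :
    RaySmooth strong (fun x => φ x - ψ x) := by
  simpa [sub_eq_add_neg] using hφ.add (hψ.const_mul (-1))

theorem sum {ι : Type*} {s : Finset ι} {f : ι → E → ℝ} (hf : ∀ i ∈ s, RaySmooth strong (f i)) :
    RaySmooth strong (fun x => ∑ i ∈ s, f i x) := by
  classical
  induction s using Finset.induction_on with
  | empty => simpa using const strong (0 : ℝ)
  | insert a s ha ih =>
    simp only [Finset.sum_insert ha]
    exact (hf a (Finset.mem_insert_self a s)).add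
      (ih fun i hi => hf i (Finset.mem_insert_of_mem hi))

theorem comp_clm {ψ : F → ℝ} (hψ : RaySmooth strong ψ) (A : E →L[ℝ] F) :
    RaySmooth strong (fun x => ψ (A x)) := by
  refine ⟨hψ.1.comp A.contDiff, ?_⟩
  have : fderiv ℝ (fun x => ψ (A x))
      = fun x => (ContinuousLinearMap.compL ℝ E F ℝ).flip A (fderiv ℝ ψ (A x)) :=
    funext fun x => ((hψ.differentiable (A x)).hasFDerivAt.comp x A.hasFDerivAt).fderiv
  rw [this]
  exact (hψ.2.comp_clm A).clm_apply _

end RaySmooth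

end RaySmooth

/-! ### Gradients, SC¹ and LC² functions -/

section Gradient

variable {E : Type*} [NormedAddCommGroup E] [InnerProductSpace ℝ E] [FiniteDimensional ℝ E]

variable (E) in
/-- The Riesz isomorphism of a finite-dimensional real inner product space, as a linear map. -/
noncomputable def rieszEquiv : E ≃L[ℝ] (E →L[ℝ] ℝ) :=
  LinearEquiv.toContinuousLinearEquiv
    { toFun := fun v => InnerProductSpace.toDual ℝ E v
      invFun := fun φ => (InnerProductSpace.toDual ℝ E).symm φ
      map_add' := fun v w => map_add _ v w
      map_smul' := fun c v => by simp
      left_inv := fun v => by simp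
      right_inv := fun φ => by simp }

theorem gradient_eq_rieszEquiv_symm (ψ : E → ℝ) (x : E) :
    gradient ψ x = (rieszEquiv E).symm (fderiv ℝ ψ x) := rfl

theorem fderiv_eq_rieszEquiv (ψ : E → ℝ) (x : E) :
    fderiv ℝ ψ x = rieszEquiv E (gradient ψ x) := by
  rw [gradient_eq_rieszEquiv_symm, ContinuousLinearEquiv.apply_symm_apply]

theorem RaySmooth.of_gradient {strong : Prop} {ψ : E → ℝ} (hψ : ContDiff ℝ 1 ψ)
    (h : RaySemismooth strong (gradient ψ)) : RaySmooth strong ψ := by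
  refine ⟨hψ, ?_⟩
  have : fderiv ℝ ψ = fun x => (rieszEquiv E : E →L[ℝ] (E →L[ℝ] ℝ)) (gradient ψ x) :=
    funext (fderiv_eq_rieszEquiv ψ)
  rw [this]
  exact h.clm_apply _

variable {ι κ : Type*} [Fintype ι] [Fintype κ]

theorem IsSC1.raySmooth {ψ : EuclideanSpace ℝ ι → ℝ} (h : IsSC1 ψ) : RaySmooth False ψ :=
  .of_gradient h.1 h.2.raySemismooth

theorem IsLC2.raySmooth {ψ : EuclideanSpace ℝ ι → ℝ} (h : IsLC2 ψ) : RaySmooth True ψ := by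
  refine .of_gradient (h.1.of_le one_le_two) (.of_locallyLipschitz_fderiv True ?_ h.2)
  exact (rieszEquiv _).symm.contDiff.comp (h.1.fderiv_right (m := 1) (by norm_num))

end Gradient

/-! ### Block vectors and the Fischer-Burmeister function -/

section Blocks

variable {ι κ : Type*} [Fintype ι] [Fintype κ]

/-- Concatenation of two vectors as a continuous linear map. -/
noncomputable def pairCLM (ι κ : Type*) [Fintype ι] [Fintype κ] :
    EuclideanSpace ℝ ι × EuclideanSpace ℝ κ →L[ℝ] EuclideanSpace ℝ (ι ⊕ κ) :=
  LinearMap.toContinuousLinearMap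
    { toFun := fun p => pair p.1 p.2
      map_add' := fun p q => by ext i; rcases i with i | i <;> simp [pair]
      map_smul' := fun c p => by ext i; rcases i with i | i <;> simp [pair] }

/-- The first block of a concatenated vector as a continuous linear map. -/
noncomputable def fstCLM (ι κ : Type*) [Fintype ι] [Fintype κ] :
    EuclideanSpace ℝ (ι ⊕ κ) →L[ℝ] EuclideanSpace ℝ ι :=
  LinearMap.toContinuousLinearMap
    { toFun := fstBlock
      map_add' := fun p q => by ext i; simp [fstBlock]
      map_smul' := fun c p => by ext i; simp [fstBlock] }

/-- The second block of a concatenated vector as a continuous linear map. -/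
noncomputable def sndCLM (ι κ : Type*) [Fintype ι] [Fintype κ] :
    EuclideanSpace ℝ (ι ⊕ κ) →L[ℝ] EuclideanSpace ℝ κ :=
  LinearMap.toContinuousLinearMap
    { toFun := sndBlock
      map_add' := fun p q => by ext i; simp [sndBlock]
      map_smul' := fun c p => by ext i; simp [sndBlock] }

@[simp] theorem pairCLM_apply (a : EuclideanSpace ℝ ι) (b : EuclideanSpace ℝ κ) :
    pairCLM ι κ (a, b) = pair a b := rfl

@[simp] theorem pair_fstBlock_sndBlock (c : EuclideanSpace ℝ (ι ⊕ κ)) :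
    pair (fstBlock c) (sndBlock c) = c := by
  ext i; rcases i with i | i <;> rfl

theorem hasFDerivAt_pair_left (a : EuclideanSpace ℝ ι) (b : EuclideanSpace ℝ κ) :
    HasFDerivAt (fun a' => pair a' b) (pairCLM ι κ ∘L .inl ℝ _ _) a :=
  (pairCLM ι κ).hasFDerivAt.comp a (hasFDerivAt_prodMk_left a b)

theorem hasFDerivAt_pair_right (a : EuclideanSpace ℝ ι) (b : EuclideanSpace ℝ κ) :
    HasFDerivAt (fun b' => pair a b') (pairCLM ι κ ∘L .inr ℝ _ _) b :=
  (pairCLM ι κ).hasFDerivAt.comp b (hasFDerivAt_prodMk_right a b)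

variable {E : Type*} [NormedAddCommGroup E] [NormedSpace ℝ E] {strong : Prop}

theorem RaySemismooth.pair {f : E → EuclideanSpace ℝ ι} {g : E → EuclideanSpace ℝ κ}
    (hf : RaySemismooth strong f) (hg : RaySemismooth strong g) :
    RaySemismooth strong (fun x => Bilevel.pair (f x) (g x)) :=
  (hf.prodMk hg).clm_apply (pairCLM ι κ)

theorem RaySemismooth.euclidean {ψ : E → EuclideanSpace ℝ ι}
    (h : ∀ i, RaySemismooth strong fun x => ψ x i) : RaySemismooth strong ψ := by
  classical
  have : ψ = fun x => ∑ i, ψ x i • EuclideanSpace.single i (1 : ℝ) := by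
    funext x
    ext j
    simp [Pi.single_apply]
  rw [this]
  exact RaySemismooth.sum fun i _ => (h i).smul (.const strong _)

theorem RaySemismooth.apply {ψ : E → EuclideanSpace ℝ ι} (h : RaySemismooth strong ψ) (i : ι) :
    RaySemismooth strong fun x => ψ x i :=
  h.clm_apply (EuclideanSpace.proj i : EuclideanSpace ℝ ι →L[ℝ] ℝ)

/-- Partial gradients of a `C¹` function with a ray-semismooth derivative are ray-semismooth
jointly in all variables. -/
theorem RaySmooth.partial_gradient {L : EuclideanSpace ℝ (ι ⊕ κ) → ℝ} (hL : RaySmooth strong L) :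
    RaySemismooth strong fun ζ =>
      gradient (fun ξ => L (Bilevel.pair ξ (sndBlock ζ))) (fstBlock ζ) := by
  have : (fun ζ => gradient (fun ξ => L (Bilevel.pair ξ (sndBlock ζ))) (fstBlock ζ)) = fun ζ =>
      ((rieszEquiv (EuclideanSpace ℝ ι)).symm : _ →L[ℝ] EuclideanSpace ℝ ι)
        ((ContinuousLinearMap.compL ℝ _ _ ℝ).flip (pairCLM ι κ ∘L .inl ℝ _ _) (fderiv ℝ L ζ)) := by
    funext ζ
    have h1 := (hL.differentiable (Bilevel.pair (fstBlock ζ) (sndBlock ζ))).hasFDerivAt.comp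
      (fstBlock ζ) (hasFDerivAt_pair_left (fstBlock ζ) (sndBlock ζ))
    have h2 := h1.fderiv
    rw [pair_fstBlock_sndBlock] at h2
    rw [gradient_eq_rieszEquiv_symm]
    exact congrArg _ h2
  rw [this]
  exact (hL.2.clm_apply _).clm_apply _

theorem raySemismooth_fischerBurmeister (strong : Prop) :
    RaySemismooth strong fun p : ℝ × ℝ => fischerBurmeister p.1 p.2 := by
  have h1 := (raySemismooth_norm strong (V := ℂ)).comp_clm
    (Complex.equivRealProdCLM.symm : ℝ × ℝ →L[ℝ] ℂ)
  have h2 : RaySemismooth strong fun p : ℝ × ℝ => -p.1 - p.2 :=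
    .of_contDiff strong (by fun_prop)
  convert h1.add h2 using 2 with p
  -- `ℂ` serves as the Euclidean plane, since `ℝ × ℝ` carries the sup norm.
  have : ‖Complex.equivRealProdCLM.symm p‖ = √(p.1 ^ 2 + p.2 ^ 2) := by
    rw [Complex.norm_def, Complex.normSq_apply]
    simp [pow_two]
  simp only [ContinuousLinearEquiv.coe_coe, this, fischerBurmeister]
  ring

theorem RaySemismooth.psiFB {a b : E → EuclideanSpace ℝ ι} (ha : RaySemismooth strong a)
    (hb : RaySemismooth strong b) : RaySemismooth strong fun x => Bilevel.psiFB (a x) (b x) :=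
  .euclidean fun i => (raySemismooth_fischerBurmeister strong).comp
    (g := fun x => (a x i, b x i)) ((ha.apply i).prodMk (hb.apply i))

theorem RaySmooth.inner {a b : E → EuclideanSpace ℝ ι} (ha : ∀ i, RaySmooth strong fun x => a x i)
    (hb : ∀ i, RaySmooth strong fun x => b x i) :
    RaySmooth strong fun x => (inner ℝ (a x) (b x) : ℝ) := by
  simp only [PiLp.inner_apply, RCLike.inner_apply, conj_trivial]
  exact RaySmooth.sum fun i _ => (hb i).mul (ha i)

theorem RaySmooth.clm_coord (strong : Prop) (A : E →L[ℝ] EuclideanSpace ℝ ι) (i : ι) :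
    RaySmooth strong fun x => A x i :=
  .of_clm strong ((EuclideanSpace.proj i : EuclideanSpace ℝ ι →L[ℝ] ℝ) ∘L A)

end Blocks

/-! ### The two systems -/

section Systems

variable {n m p q : ℕ}

/-- Componentwise, `∂ℓ̄/∂yⱼ = ∂f/∂yⱼ - ∑ᵢ zᵢ ∂gᵢ/∂yⱼ`. -/
theorem gradYLagrangianBar_apply {f : EuclideanSpace ℝ (Fin n ⊕ Fin m) → ℝ}
    {g : EuclideanSpace ℝ (Fin n ⊕ Fin m) → EuclideanSpace ℝ (Fin q)}
    (hf : Differentiable ℝ f) (hg : ∀ i, Differentiable ℝ fun ξ => g ξ i)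
    (x : EuclideanSpace ℝ (Fin n)) (y : EuclideanSpace ℝ (Fin m)) (z : EuclideanSpace ℝ (Fin q))
    (j : Fin m) :
    gradYLagrangianBar f g x y z j = gradient f (pair x y) (Sum.inr j)
      - ∑ i, z i * gradient (fun ξ => g ξ i) (pair x y) (Sum.inr j) := by
  have hcoord : ∀ {ι : Type} [Fintype ι] [DecidableEq ι] (φ : EuclideanSpace ℝ ι → ℝ)
      (v : EuclideanSpace ℝ ι) (i : ι),
      gradient φ v i = fderiv ℝ φ v (EuclideanSpace.single i 1) := by
    intro ι _ _ φ v i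
    rw [← inner_gradient_left, EuclideanSpace.inner_single_right]
    simp
  have hpair : pair (0 : EuclideanSpace ℝ (Fin n)) (EuclideanSpace.single j (1 : ℝ))
      = EuclideanSpace.single (Sum.inr j) (1 : ℝ) := by
    ext i
    rcases i with i | i <;> simp [pair, PiLp.single_apply]
  have hder : ∀ {φ : EuclideanSpace ℝ (Fin n ⊕ Fin m) → ℝ}, Differentiable ℝ φ →
      HasFDerivAt (fun y' => φ (pair x y'))
        (fderiv ℝ φ (pair x y) ∘L (pairCLM (Fin n) (Fin m) ∘L .inr ℝ _ _)) y := fun hφ =>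
    (hφ _).hasFDerivAt.comp y (hasFDerivAt_pair_right x y)
  have hL : HasFDerivAt (fun y' => lowerLagrangianBar f g x y' z)
      (fderiv ℝ f (pair x y) ∘L (pairCLM (Fin n) (Fin m) ∘L .inr ℝ _ _)
        - ∑ i, z i • (fderiv ℝ (fun ξ => g ξ i) (pair x y) ∘L
          (pairCLM (Fin n) (Fin m) ∘L .inr ℝ _ _))) y := by
    have h := (hder hf).sub (HasFDerivAt.fun_sum (u := Finset.univ)
      fun i _ => (hder (hg i)).const_mul (z i))
    refine h.congr_of_eventuallyEq (Eventually.of_forall fun y' => ?_)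
    simp [lowerLagrangianBar, PiLp.inner_apply, mul_comm]
  rw [gradYLagrangianBar, hcoord, hL.fderiv]
  simp [hcoord, hpair]

variable {strong : Prop} {F f : EuclideanSpace ℝ (Fin n ⊕ Fin m) → ℝ}
  {G : EuclideanSpace ℝ (Fin n ⊕ Fin m) → EuclideanSpace ℝ (Fin p)}
  {g : EuclideanSpace ℝ (Fin n ⊕ Fin m) → EuclideanSpace ℝ (Fin q)}

/-- The components of `∇f` and `∇gᵢ` are themselves `C¹` with ray-semismooth derivative, so that
`∇₂ ℓ̄`, which enters the Lagrangian, is again of this kind. -/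
theorem raySemismooth_kktSystem (lam : ℝ) (hf : ContDiff ℝ 1 f) (hg : ContDiff ℝ 1 g)
    (hF : RaySmooth strong F) (hG : ∀ i, RaySmooth strong fun ξ => G ξ i)
    (hdf : ∀ j, RaySmooth strong fun ξ => gradient f ξ j)
    (hdg : ∀ i j, RaySmooth strong fun ξ => gradient (fun ξ' => g ξ' i) ξ j) :
    RaySemismooth strong (kktSystem lam F G f g) := by
  have hgi : ∀ i, ContDiff ℝ 1 fun ξ => g ξ i := fun i =>
    (EuclideanSpace.proj i : EuclideanSpace ℝ (Fin q) →L[ℝ] ℝ).contDiff.comp hg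
  have hgS : ∀ i, RaySmooth strong fun ξ => g ξ i := fun i =>
    .of_gradient (hgi i) (.euclidean fun j => (hdg i j).raySemismooth)
  let Z := EuclideanSpace ℝ ((Fin n ⊕ Fin m ⊕ Fin q) ⊕ (Fin m ⊕ Fin p ⊕ Fin q ⊕ Fin q))
  let x : Z →L[ℝ] EuclideanSpace ℝ (Fin n) := fstCLM _ _ ∘L fstCLM _ _
  let y : Z →L[ℝ] EuclideanSpace ℝ (Fin m) := fstCLM _ _ ∘L sndCLM _ _ ∘L fstCLM _ _
  let z : Z →L[ℝ] EuclideanSpace ℝ (Fin q) := sndCLM _ _ ∘L sndCLM _ _ ∘L fstCLM _ _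
  let s : Z →L[ℝ] EuclideanSpace ℝ (Fin m) := fstCLM _ _ ∘L sndCLM _ _
  let u : Z →L[ℝ] EuclideanSpace ℝ (Fin p) := fstCLM _ _ ∘L sndCLM _ _ ∘L sndCLM _ _
  let v : Z →L[ℝ] EuclideanSpace ℝ (Fin q) :=
    fstCLM _ _ ∘L sndCLM _ _ ∘L sndCLM _ _ ∘L sndCLM _ _
  let w : Z →L[ℝ] EuclideanSpace ℝ (Fin q) :=
    sndCLM _ _ ∘L sndCLM _ _ ∘L sndCLM _ _ ∘L sndCLM _ _
  let xy : Z →L[ℝ] EuclideanSpace ℝ (Fin n ⊕ Fin m) := pairCLM _ _ ∘L x.prod y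
  have hgy : ∀ j, RaySmooth strong fun ζ => gradYLagrangianBar f g (x ζ) (y ζ) (z ζ) j := by
    intro j
    simp only [gradYLagrangianBar_apply (hf.differentiable one_ne_zero)
      fun i => (hgi i).differentiable one_ne_zero]
    exact ((hdf (Sum.inr j)).comp_clm xy).sub (RaySmooth.sum fun i _ =>
      (RaySmooth.clm_coord strong z i).mul ((hdg i (Sum.inr j)).comp_clm xy))
  have hL : RaySmooth strong fun ζ =>
      kktLagrangian lam F G f g (x ζ) (y ζ) (z ζ) (s ζ) (u ζ) (v ζ) (w ζ) := by
    have h1 : RaySmooth strong fun ζ => F (pair (x ζ) (y ζ)) := hF.comp_clm xy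
    have h2 : RaySmooth strong fun ζ => inner ℝ (u ζ) (G (pair (x ζ) (y ζ))) :=
      .inner (.clm_coord strong u) fun i => (hG i).comp_clm xy
    have h3 : RaySmooth strong fun ζ => inner ℝ (v ζ + lam • z ζ) (g (pair (x ζ) (y ζ))) :=
      .inner (.clm_coord strong (v + lam • z)) fun i => (hgS i).comp_clm xy
    have h4 : RaySmooth strong fun ζ =>
        inner ℝ (s ζ) (gradYLagrangianBar f g (x ζ) (y ζ) (z ζ)) :=
      .inner (.clm_coord strong s) hgy
    have h5 : RaySmooth strong fun ζ => inner ℝ (w ζ) (z ζ) :=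
      .inner (.clm_coord strong w) (.clm_coord strong z)
    exact (((h1.add h2).add h3).add h4).add h5
  have hu : ∀ {k : ℕ} (A : Z →L[ℝ] EuclideanSpace ℝ (Fin k)), RaySemismooth strong fun ζ => A ζ :=
    fun A => .of_contDiff strong A.contDiff
  have hGS : RaySemismooth strong fun ζ => -G (pair (x ζ) (y ζ)) :=
    (RaySemismooth.euclidean fun i => ((hG i).comp_clm xy).raySemismooth).neg
  have hgS' : RaySemismooth strong fun ζ => -g (pair (x ζ) (y ζ)) :=
    (RaySemismooth.euclidean fun i => ((hgS i).comp_clm xy).raySemismooth).neg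
  exact hL.partial_gradient.pair ((RaySemismooth.euclidean fun j => (hgy j).raySemismooth).pair
    ((hGS.psiFB (hu u)).pair ((hgS'.psiFB (hu v)).pair ((hu z).neg.psiFB (hu w)))))

theorem raySemismooth_vfSystem (lam : ℝ)
    (hF : RaySmooth strong F) (hG : ∀ i, RaySmooth strong fun ξ => G ξ i)
    (hf : RaySmooth strong f) (hg : ∀ i, RaySmooth strong fun ξ => g ξ i) :
    RaySemismooth strong (vfSystem lam F G f g) := by
  let Z := EuclideanSpace ℝ ((Fin n ⊕ Fin m ⊕ Fin m) ⊕ (Fin p ⊕ Fin q ⊕ Fin q))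
  let x : Z →L[ℝ] EuclideanSpace ℝ (Fin n) := fstCLM _ _ ∘L fstCLM _ _
  let y : Z →L[ℝ] EuclideanSpace ℝ (Fin m) := fstCLM _ _ ∘L sndCLM _ _ ∘L fstCLM _ _
  let z : Z →L[ℝ] EuclideanSpace ℝ (Fin m) := sndCLM _ _ ∘L sndCLM _ _ ∘L fstCLM _ _
  let u : Z →L[ℝ] EuclideanSpace ℝ (Fin p) := fstCLM _ _ ∘L sndCLM _ _
  let v : Z →L[ℝ] EuclideanSpace ℝ (Fin q) := fstCLM _ _ ∘L sndCLM _ _ ∘L sndCLM _ _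
  let w : Z →L[ℝ] EuclideanSpace ℝ (Fin q) := sndCLM _ _ ∘L sndCLM _ _ ∘L sndCLM _ _
  let xy : Z →L[ℝ] EuclideanSpace ℝ (Fin n ⊕ Fin m) := pairCLM _ _ ∘L x.prod y
  let xz : Z →L[ℝ] EuclideanSpace ℝ (Fin n ⊕ Fin m) := pairCLM _ _ ∘L x.prod z
  have hL : RaySmooth strong fun ζ =>
      vfLagrangian lam F G f g (x ζ) (y ζ) (z ζ) (u ζ) (v ζ) (w ζ) := by
    have h1 : RaySmooth strong fun ζ => F (pair (x ζ) (y ζ)) := hF.comp_clm xy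
    have h2 : RaySmooth strong fun ζ => inner ℝ (u ζ) (G (pair (x ζ) (y ζ))) :=
      .inner (.clm_coord strong u) fun i => (hG i).comp_clm xy
    have h3 : RaySmooth strong fun ζ => inner ℝ (v ζ) (g (pair (x ζ) (y ζ))) :=
      .inner (.clm_coord strong v) fun i => (hg i).comp_clm xy
    have h4 : RaySmooth strong fun ζ => lam * f (pair (x ζ) (y ζ)) :=
      (hf.comp_clm xy).const_mul lam
    have h5 : RaySmooth strong fun ζ => inner ℝ (w ζ) (g (pair (x ζ) (z ζ))) :=
      .inner (.clm_coord strong w) fun i => (hg i).comp_clm xz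
    have h6 : RaySmooth strong fun ζ => lam * lowerLagrangian f g (x ζ) (z ζ) (w ζ) :=
      ((hf.comp_clm xz).add h5).const_mul lam
    exact (((h1.add h2).add h3).add h4).sub h6
  have hu : ∀ {k : ℕ} (A : Z →L[ℝ] EuclideanSpace ℝ (Fin k)), RaySemismooth strong fun ζ => A ζ :=
    fun A => .of_contDiff strong A.contDiff
  have hGS : RaySemismooth strong fun ζ => -G (pair (x ζ) (y ζ)) :=
    (RaySemismooth.euclidean fun i => ((hG i).comp_clm xy).raySemismooth).neg
  have hgS : RaySemismooth strong fun ζ => -g (pair (x ζ) (y ζ)) :=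
    (RaySemismooth.euclidean fun i => ((hg i).comp_clm xy).raySemismooth).neg
  have hgS' : RaySemismooth strong fun ζ => -g (pair (x ζ) (z ζ)) :=
    (RaySemismooth.euclidean fun i => ((hg i).comp_clm xz).raySemismooth).neg
  exact hL.partial_gradient.pair
    ((hGS.psiFB (hu u)).pair ((hgS.psiFB (hu v)).pair (hgS'.psiFB (hu w))))

end Systems

end Bilevel

theorem theorem3p2 {n m p q : ℕ}
    (F : EuclideanSpace ℝ (Fin n ⊕ Fin m) → ℝ)
    (G : EuclideanSpace ℝ (Fin n ⊕ Fin m) → EuclideanSpace ℝ (Fin p))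
    (f : EuclideanSpace ℝ (Fin n ⊕ Fin m) → ℝ)
    (g : EuclideanSpace ℝ (Fin n ⊕ Fin m) → EuclideanSpace ℝ (Fin q))
    (lam₁ lam₂ : ℝ) :
    (ContDiff ℝ 1 f → ContDiff ℝ 1 g →
      (Bilevel.IsSC1 F → Bilevel.IsSC1Vec G → Bilevel.IsSC1Vec (gradient f) →
        (∀ i, Bilevel.IsSC1Vec (gradient fun ξ => g ξ i)) →
        Bilevel.IsSemismooth (Bilevel.kktSystem lam₁ F G f g)) ∧
      (Bilevel.IsLC2 F → Bilevel.IsLC2Vec G → Bilevel.IsLC2Vec (gradient f) →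
        (∀ i, Bilevel.IsLC2Vec (gradient fun ξ => g ξ i)) →
        Bilevel.IsStronglySemismooth (Bilevel.kktSystem lam₁ F G f g))) ∧
    ((Bilevel.IsSC1 F → Bilevel.IsSC1Vec G → Bilevel.IsSC1 f → Bilevel.IsSC1Vec g →
        Bilevel.IsSemismooth (Bilevel.vfSystem lam₂ F G f g)) ∧
      (Bilevel.IsLC2 F → Bilevel.IsLC2Vec G → Bilevel.IsLC2 f → Bilevel.IsLC2Vec g →
        Bilevel.IsStronglySemismooth (Bilevel.vfSystem lam₂ F G f g))) := by
  refine ⟨fun hf hg => ⟨fun hF hG hdf hdg => ?_, fun hF hG hdf hdg => ?_⟩,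
    fun hF hG hf hg => ?_, fun hF hG hf hg => ?_⟩
  · exact (Bilevel.raySemismooth_kktSystem lam₁ hf hg hF.raySmooth (fun i => (hG i).raySmooth)
      (fun j => (hdf j).raySmooth) fun i j => (hdg i j).raySmooth).isSemismooth
  · exact (Bilevel.raySemismooth_kktSystem lam₁ hf hg hF.raySmooth (fun i => (hG i).raySmooth)
      (fun j => (hdf j).raySmooth) fun i j => (hdg i j).raySmooth).isStronglySemismooth
  · exact (Bilevel.raySemismooth_vfSystem lam₂ hF.raySmooth (fun i => (hG i).raySmooth)
      hf.raySmooth fun i => (hg i).raySmooth).isSemismooth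
  · exact (Bilevel.raySemismooth_vfSystem lam₂ hF.raySmooth (fun i => (hG i).raySmooth)
      hf.raySmooth fun i => (hg i).raySmooth).isStronglySemismooth
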